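/- Let $M,N\ge 0$ be integers with $M+N\ge 1$, and let $X_1,\dots,X_M,Y_1,\dots,Y_N$ be independent normal random variables with zero means, where $X_i$ has variance $\sigma_{X_i}^2$ and $Y_j$ has variance $\sigma_{Y_j}^2$, with $\sigma_{X_i}>0$ and $\sigma_{Y_j}>0$. Put $\sigma_M=\prod_{i=1}^M\sigma_{X_i}$, $s_N=\prod_{j=1}^N\sigma_{Y_j}$ and $$Z=\frac{X_1\cdots X_M}{Y_1\cdots Y_N},$$ where empty products equal $1$. Let $F_Z(z)=\mathbb{P}(Z\le z)$ and, for $0<p<1$, let $Q(p)=F_Z^{-1}(p)=\inf\{z\in\mathbb{R}: F_Z(z)\ge p\}$ be the quantile function of $Z$. Write $f(p)\sim g(p)$ if $f(p)/g(p)\to 1$ in the stated limit. (i) Suppose $M\ge 0$ and $N\ge 1$. Then, as $p\to 0^+$, $$Q(p)\sim-\frac{2^{(M+N-2)/2}\,\sigma_M}{\pi^{(M+N)/2}\,s_N\,(N-1)!}\cdot\frac{(\ln(1/p))^{N-1}}{p}.$$ (ii) Suppose $M\ge 1$ and $N=0$. Then, as $p\to 0^+$, $$Q(p)\sim-\left(\frac{2\,\sigma_M^{2/M}}{M}\,\ln(1/p)\right)^{M/2}.$$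 -/

import Mathlib

open MeasureTheory ProbabilityTheory Filter Topology Asymptotics
open scoped Nat

/-- The quantile function `Q(p) = inf {x : p ≤ F(x)}` of a probability measure on `ℝ` with
cumulative distribution function `F`. For `0 < p < 1` this is the generalized inverse of `F`; it is
the ordinary inverse `F⁻¹(p)` when `F` is continuous and strictly increasing. -/
noncomputable def quantile (μ : Measure ℝ) (p : ℝ) : ℝ :=
  sInf {x : ℝ | p ≤ cdf μ x}

/-- The ratio `Z = (X₁ ⋯ X_M) / (Y₁ ⋯ Y_N)`. An empty product is `1`. -/
noncomputable def productRatio {Ω : Type*} {M N : ℕ}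
    (X : Fin M → Ω → ℝ) (Y : Fin N → Ω → ℝ) (ω : Ω) : ℝ :=
  (∏ i, X i ω) / (∏ j, Y j ω)

/-! A factor with a symmetric law makes `Z` symmetric, so for `x > 0` the lower tail `P(Z ≤ -x)` is
half of `P(|Z| ≥ x)`. It remains to find this two-sided tail and to invert it.

If `N ≥ 1`, the tail comes from a denominator close to zero. Let `G x = P(x U ≤ 1)` for a
nonnegative `U`. Multiplying `U` by an independent `|Y|`, with `Y` centred Gaussian of density `w`,
turns `G x` into `2 ∫_0^∞ w(y) G(xy) dy`, which behaves like `(2 w(0) / x) ∫_0^x G` because the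
primitive of `G` varies slowly (`tendsto_gaussian_average`). Integrating `K (log t)^n / t` raises
the power of the logarithm and divides by `n + 1`; iterating yields `(log x)^(N-1) / (N-1)!`
together with one factor `2 w(0)` per `Y j`. The numerator has finite mean and only multiplies the
tail by `∏ E|X i|` (`tendsto_average_div`). This tail is known up to a factor `1 + o(1)`, and
`isEquivalent_quantile_of_log_pow_div` inverts it.

If `N = 0`, normalise to standard Gaussians `W i`. By AM-GM, `∏ |W i| ≥ t^(M/2)` forces `∑ W i ^ 2 ≥
M t`, so Chernoff gives decay at every rate below `M/2`; conversely the event contains `|W i| ≥ √t`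
for all `i`, so no rate above `M/2` is possible. Knowing the exponential rate alone suffices, since
the quantile is a power of `log (1/p)` (`isEquivalent_quantile_of_exp_tail`). -/

/-! ### Logarithmic asymptotics and averages of antitone functions -/

/-- `log (c * x)` and `log x` agree to leading order. -/
lemma tendsto_log_const_mul_div_log {c : ℝ} (hc : 0 < c) :
    Tendsto (fun x : ℝ => Real.log (c * x) / Real.log x) atTop (𝓝 1) := by
  have h : Tendsto (fun x : ℝ => Real.log c / Real.log x + 1) atTop (𝓝 (0 + 1)) :=
    (tendsto_const_nhds.div_atTop Real.tendsto_log_atTop).add_const 1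
  rw [zero_add] at h
  refine h.congr' ?_
  filter_upwards [eventually_gt_atTop 1] with x hx
  have hl : Real.log x ≠ 0 := (Real.log_pos hx).ne'
  rw [Real.log_mul hc.ne' (by positivity)]
  field_simp

/-- If `f x / (log x) ^ n → K` then the same limit holds along `f (c * x)`. -/
lemma tendsto_comp_const_mul_div_log_pow {f : ℝ → ℝ} {n : ℕ} {K c : ℝ} (hc : 0 < c)
    (hf : Tendsto (fun x => f x / Real.log x ^ n) atTop (𝓝 K)) :
    Tendsto (fun x => f (c * x) / Real.log x ^ n) atTop (𝓝 K) := by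
  have h1 : Tendsto (fun x : ℝ => c * x) atTop atTop := tendsto_id.const_mul_atTop hc
  have h := (hf.comp h1).mul ((tendsto_log_const_mul_div_log hc).pow n)
  rw [one_pow, mul_one] at h
  refine h.congr' ?_
  filter_upwards [h1.eventually (eventually_gt_atTop 1), eventually_gt_atTop 1] with x hx hx1
  have hl : Real.log x ≠ 0 := (Real.log_pos hx1).ne'
  have hl' : Real.log (c * x) ≠ 0 := (Real.log_pos hx).ne'
  simp only [Function.comp, div_pow]
  field_simp

lemma integral_log_pow_div (n : ℕ) {a b : ℝ} (ha : 0 < a) (hab : a ≤ b) :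
    IntervalIntegrable (fun t : ℝ => Real.log t ^ n / t) volume a b ∧
      ∫ t in a..b, Real.log t ^ n / t =
        (Real.log b ^ (n + 1) - Real.log a ^ (n + 1)) / ((n : ℝ) + 1) := by
  have hpos : ∀ t ∈ Set.uIcc a b, t ≠ 0 := fun t ht => by
    rw [Set.uIcc_of_le hab] at ht
    exact (ha.trans_le ht.1).ne'
  have hint : IntervalIntegrable (fun t : ℝ => Real.log t ^ n / t) volume a b :=
    ContinuousOn.intervalIntegrable
      (((Real.continuousOn_log.mono fun t ht => hpos t ht).pow n).div continuousOn_id hpos)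
  refine ⟨hint, ?_⟩
  have hd : ∀ t ∈ Set.uIcc a b, HasDerivAt (fun t : ℝ => Real.log t ^ (n + 1) / ((n : ℝ) + 1))
      (Real.log t ^ n / t) t := fun t ht => by
    have h := ((Real.hasDerivAt_log (hpos t ht)).pow (n + 1)).div_const ((n : ℝ) + 1)
    refine h.congr_deriv ?_
    have : (n : ℝ) + 1 ≠ 0 := by positivity
    have := hpos t ht
    push_cast
    field_simp
  rw [intervalIntegral.integral_eq_sub_of_hasDerivAt hd hint, sub_div]

/-- Integrating the asymptotics `G x ~ K (log x) ^ n / x`. -/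
lemma tendsto_integral_div_log_pow {G : ℝ → ℝ} (hG : Antitone G) {n : ℕ} {K : ℝ}
    (h : Tendsto (fun x => G x * x / Real.log x ^ n) atTop (𝓝 K)) :
    Tendsto (fun x => (∫ t in (0 : ℝ)..x, G t) / Real.log x ^ (n + 1)) atTop
      (𝓝 (K / ((n : ℝ) + 1))) := by
  have hGi : ∀ a b : ℝ, IntervalIntegrable G volume a b := fun a b => hG.intervalIntegrable
  have hlog : Tendsto (fun x : ℝ => Real.log x ^ (n + 1)) atTop atTop :=
    (tendsto_pow_atTop n.succ_ne_zero).comp Real.tendsto_log_atTop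
  set D : ℝ → ℝ := fun x => (∫ t in (0 : ℝ)..x, G t) - K / ((n : ℝ) + 1) * Real.log x ^ (n + 1)
    with hD
  have hn : (1 : ℝ) ≤ (n : ℝ) + 1 := by
    have : (0 : ℝ) ≤ n := n.cast_nonneg
    linarith
  -- Past `x₀` the integrands differ by at most `c / 2` times `log t ^ n / t`. The constant `D x₀`
  -- costs another `c / 2` once the logarithm is large.
  have key : D =o[atTop] fun x : ℝ => Real.log x ^ (n + 1) := by
    rw [isLittleO_iff]
    intro c hc
    have h1 : ∀ᶠ x in atTop, |G x * x / Real.log x ^ n - K| ≤ c / 2 := by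
      have := (Metric.tendsto_nhds.1 h) (c / 2) (by positivity)
      filter_upwards [this] with x hx
      exact (Real.dist_eq _ _ ▸ hx).le
    obtain ⟨x₀, hx₀⟩ := eventually_atTop.1 (h1.and (eventually_gt_atTop 1))
    have hx₀1 : 1 < x₀ := (hx₀ x₀ le_rfl).2
    filter_upwards [hlog.eventually_ge_atTop (|D x₀| / (c / 2)), eventually_ge_atTop x₀]
      with x hx hxx
    have hx1 : 1 < x := hx₀1.trans_le hxx
    obtain ⟨hi, he⟩ := integral_log_pow_div n (by linarith : (0 : ℝ) < x₀) hxx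
    have hsub : D x - D x₀ = ∫ t in x₀..x, (G t - K * (Real.log t ^ n / t)) := by
      rw [intervalIntegral.integral_sub (hGi _ _) (hi.const_mul K),
        intervalIntegral.integral_const_mul, he,
        ← intervalIntegral.integral_interval_sub_left (hGi 0 x) (hGi 0 x₀)]
      simp only [hD]
      ring
    have hle : ‖D x - D x₀‖ ≤ ∫ t in x₀..x, c / 2 * (Real.log t ^ n / t) := by
      rw [hsub]
      refine intervalIntegral.norm_integral_le_of_norm_le hxx ?_ (hi.const_mul _)
      refine ae_of_all _ fun t ht => ?_
      obtain ⟨ht1, ht2⟩ := hx₀ t ht.1.le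
      have hl : 0 < Real.log t := Real.log_pos ht2
      have ht0 : 0 < t := by linarith
      have : G t - K * (Real.log t ^ n / t)
          = (G t * t / Real.log t ^ n - K) * (Real.log t ^ n / t) := by
        field_simp
      rw [this, norm_mul, Real.norm_eq_abs, Real.norm_of_nonneg (by positivity)]
      gcongr
    rw [intervalIntegral.integral_const_mul, he] at hle
    have hL0 : 0 ≤ Real.log x₀ ^ (n + 1) := by
      have := Real.log_pos hx₀1
      positivity
    have hLx : 0 ≤ Real.log x ^ (n + 1) := by
      have := Real.log_pos hx1
      positivity
    have h3 : (Real.log x ^ (n + 1) - Real.log x₀ ^ (n + 1)) / ((n : ℝ) + 1)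
        ≤ Real.log x ^ (n + 1) := by
      rw [div_le_iff₀ (by linarith)]
      nlinarith
    rw [div_le_iff₀ (by positivity)] at hx
    have h4 : c / 2 * ((Real.log x ^ (n + 1) - Real.log x₀ ^ (n + 1)) / ((n : ℝ) + 1))
        ≤ c / 2 * Real.log x ^ (n + 1) := by gcongr
    have h5 : ‖D x‖ ≤ ‖D x - D x₀‖ + ‖D x₀‖ := by
      simpa using norm_add_le (D x - D x₀) (D x₀)
    rw [Real.norm_of_nonneg hLx]
    rw [Real.norm_eq_abs (D x₀)] at h5
    nlinarith
  have h2 := key.tendsto_div_nhds_zero.add_const (K / ((n : ℝ) + 1))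
  rw [zero_add] at h2
  refine h2.congr' ?_
  filter_upwards [eventually_gt_atTop 1] with x hx
  have hl : Real.log x ≠ 0 := (Real.log_pos hx).ne'
  simp only [hD]
  field_simp
  ring

/-- An antitone function whose primitive is slowly varying is negligible against it. -/
lemma tendsto_mul_self_div_log_pow_zero {G : ℝ → ℝ} (hG : Antitone G) (h0 : ∀ x, 0 ≤ G x)
    {n : ℕ} {K : ℝ}
    (h : Tendsto (fun x => (∫ t in (0 : ℝ)..x, G t) / Real.log x ^ n) atTop (𝓝 K)) :
    Tendsto (fun x => G x * x / Real.log x ^ n) atTop (𝓝 0) := by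
  have hGi : ∀ a b : ℝ, IntervalIntegrable G volume a b := fun a b => hG.intervalIntegrable
  -- Monotonicity gives `G x * (x / 2) ≤ ∫_{x/2}^x G`, and the primitives at `x` and `x / 2` have
  -- the same normalised limit.
  have h1 := (h.sub (tendsto_comp_const_mul_div_log_pow
    (f := fun x => ∫ t in (0 : ℝ)..x, G t) (c := 1 / 2) (by norm_num) h)).const_mul 2
  rw [sub_self, mul_zero] at h1
  refine tendsto_of_tendsto_of_tendsto_of_le_of_le' tendsto_const_nhds h1 ?_ ?_
  · filter_upwards [eventually_gt_atTop 1] with x hx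
    have hl := Real.log_pos hx
    have := h0 x
    positivity
  · filter_upwards [eventually_gt_atTop 1] with x hx
    have hl := Real.log_pos hx
    have hle : ∫ _ in (1 / 2 * x)..x, G x ≤ ∫ t in (1 / 2 * x)..x, G t := by
      refine intervalIntegral.integral_mono_on (by linarith) (by simp) (hGi _ _) fun t ht => ?_
      exact hG ht.2
    rw [← intervalIntegral.integral_interval_sub_left (hGi 0 x) (hGi 0 _),
      intervalIntegral.integral_const, smul_eq_mul] at hle
    rw [← sub_div, ← mul_div_assoc]
    exact div_le_div_of_nonneg_right (by linarith) (by positivity)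

lemma gaussianPDFReal_zero_antitoneOn (v : NNReal) :
    AntitoneOn (gaussianPDFReal 0 v) (Set.Ici 0) := by
  intro a ha b hb hab
  simp only [gaussianPDFReal, sub_zero]
  have : a ^ 2 ≤ b ^ 2 := by
    have : 0 ≤ a := ha
    gcongr
  gcongr

lemma integral_comp_abs_gaussianReal {v : NNReal} (hv : v ≠ 0) (g : ℝ → ℝ) :
    ∫ y, g |y| ∂gaussianReal 0 v =
      2 * ∫ y in Set.Ioi (0 : ℝ), gaussianPDFReal 0 v y * g y := by
  rw [integral_gaussianReal_eq_integral_smul hv, ← integral_comp_abs]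
  congr 1
  ext y
  simp [gaussianPDFReal]

/-- Two-sided estimate for the Gaussian average of an antitone function. -/
lemma gaussian_average_bounds {v : NNReal} (hv : v ≠ 0) {G : ℝ → ℝ} (hG : Antitone G)
    (h0 : ∀ x, 0 ≤ G x) (h1 : ∀ x, G x ≤ 1) {x δ : ℝ} (hx : 0 < x) (hδ : 0 < δ) :
    2 * gaussianPDFReal 0 v δ * (∫ t in (0 : ℝ)..(δ * x), G t) ≤
        (∫ y, G (x * |y|) ∂gaussianReal 0 v) * x ∧
      (∫ y, G (x * |y|) ∂gaussianReal 0 v) * x ≤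
        2 * gaussianPDFReal 0 v 0 * (∫ t in (0 : ℝ)..x, G t) + 2 * (G x * x) := by
  set w := gaussianPDFReal 0 v with hw
  have hw0 : ∀ y, 0 ≤ w y := gaussianPDFReal_nonneg 0 v
  have hwi : Integrable w := integrable_gaussianPDFReal 0 v
  have hGx : Antitone fun y => G (x * y) := fun a b hab => hG (by gcongr)
  have hint : Integrable fun y => w y * G (x * y) := by
    refine hwi.mono' (hwi.1.mul hGx.measurable.aestronglyMeasurable) (ae_of_all _ fun y => ?_)
    rw [Real.norm_of_nonneg (mul_nonneg (hw0 y) (h0 _))]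
    exact mul_le_of_le_one_right (hw0 y) (h1 _)
  rw [integral_comp_abs_gaussianReal hv fun y => G (x * y)]
  have hscale : ∀ c : ℝ, (∫ t in (0 : ℝ)..(c * x), G t) = x * ∫ y in (0 : ℝ)..c, G (x * y) := by
    intro c
    rw [intervalIntegral.mul_integral_comp_mul_left, mul_zero, mul_comm]
  have hconst : ∀ a c : ℝ, IntervalIntegrable (fun y => a * G (x * y)) volume 0 c :=
    fun a c => hGx.intervalIntegrable.const_mul a
  constructor
  · have hle : w δ * (∫ y in (0 : ℝ)..δ, G (x * y)) ≤
        ∫ y in Set.Ioi (0 : ℝ), w y * G (x * y) := by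
      rw [← intervalIntegral.integral_const_mul]
      calc ∫ y in (0 : ℝ)..δ, w δ * G (x * y) ≤ ∫ y in (0 : ℝ)..δ, w y * G (x * y) := by
            refine intervalIntegral.integral_mono_on hδ.le (hconst _ _)
              hint.intervalIntegrable fun y hy => ?_
            exact mul_le_mul_of_nonneg_right
              (gaussianPDFReal_zero_antitoneOn v hy.1 hδ.le hy.2) (h0 _)
        _ = ∫ y in Set.Ioc (0 : ℝ) δ, w y * G (x * y) := intervalIntegral.integral_of_le hδ.le
        _ ≤ _ := setIntegral_mono_set hint.integrableOn
              (ae_of_all _ fun y => mul_nonneg (hw0 y) (h0 _))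
              (Set.Ioc_subset_Ioi_self).eventuallyLE
    rw [hscale]
    nlinarith
  · have hsplit : ∫ y in Set.Ioi (0 : ℝ), w y * G (x * y) =
        (∫ y in (0 : ℝ)..1, w y * G (x * y)) + ∫ y in Set.Ioi (1 : ℝ), w y * G (x * y) :=
      (intervalIntegral.integral_interval_add_Ioi hint.integrableOn hint.integrableOn).symm
    have hA : ∫ y in (0 : ℝ)..1, w y * G (x * y) ≤ w 0 * ∫ y in (0 : ℝ)..1, G (x * y) := by
      rw [← intervalIntegral.integral_const_mul]
      refine intervalIntegral.integral_mono_on zero_le_one hint.intervalIntegrable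
        (hconst _ _) fun y hy => ?_
      exact mul_le_mul_of_nonneg_right
        (gaussianPDFReal_zero_antitoneOn v Set.self_mem_Ici hy.1 hy.1) (h0 _)
    have hB : ∫ y in Set.Ioi (1 : ℝ), w y * G (x * y) ≤ G x := by
      calc ∫ y in Set.Ioi (1 : ℝ), w y * G (x * y) ≤ ∫ y in Set.Ioi (1 : ℝ), w y * G x := by
            refine setIntegral_mono_on hint.integrableOn (hwi.mul_const _).integrableOn
              measurableSet_Ioi fun y hy => ?_
            have : 1 < y := hy
            exact mul_le_mul_of_nonneg_left (hG (by nlinarith)) (hw0 y)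
        _ ≤ ∫ y, w y * G x := setIntegral_le_integral (hwi.mul_const _)
            (ae_of_all _ fun y => mul_nonneg (hw0 y) (h0 _))
        _ = G x := by rw [integral_mul_const, hw, integral_gaussianPDFReal_eq_one 0 hv, one_mul]
    have h1x := hscale 1
    rw [one_mul] at h1x
    rw [hsplit, h1x]
    nlinarith

/-- Multiplying by an independent centred Gaussian integrates the tail once. -/
lemma tendsto_gaussian_average {v : NNReal} (hv : v ≠ 0) {G : ℝ → ℝ} (hG : Antitone G)
    (h0 : ∀ x, 0 ≤ G x) (h1 : ∀ x, G x ≤ 1) {n : ℕ} {K : ℝ}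
    (h : Tendsto (fun x => (∫ t in (0 : ℝ)..x, G t) / Real.log x ^ n) atTop (𝓝 K)) :
    Tendsto (fun x => (∫ y, G (x * |y|) ∂gaussianReal 0 v) * x / Real.log x ^ n) atTop
      (𝓝 (2 * gaussianPDFReal 0 v 0 * K)) := by
  rw [tendsto_order]
  constructor
  · intro a ha
    -- Continuity of the density at `0` lets a fixed small `δ` lose arbitrarily little; the scale
    -- `δ` then disappears from the limit because `log (δ * x) ~ log x`.
    have hc : Tendsto (fun δ => 2 * gaussianPDFReal 0 v δ * K) (𝓝[>] 0)
        (𝓝 (2 * gaussianPDFReal 0 v 0 * K)) := by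
      have : Continuous fun δ => 2 * gaussianPDFReal 0 v δ * K := by
        unfold gaussianPDFReal
        fun_prop
      exact (this.tendsto 0).mono_left nhdsWithin_le_nhds
    obtain ⟨δ, hδa, hδ⟩ := ((hc.eventually_const_lt ha).and self_mem_nhdsWithin).exists
    have hδ0 : 0 < δ := hδ
    have hlow := (tendsto_comp_const_mul_div_log_pow hδ0 h).const_mul
      (2 * gaussianPDFReal 0 v δ)
    filter_upwards [hlow.eventually_const_lt hδa, eventually_gt_atTop 1] with x hx hx1
    have hl := Real.log_pos hx1
    refine hx.trans_le ?_
    rw [← mul_div_assoc]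
    exact div_le_div_of_nonneg_right
      (gaussian_average_bounds hv hG h0 h1 (by linarith) hδ0).1 (by positivity)
  · intro a ha
    have hup := (h.const_mul (2 * gaussianPDFReal 0 v 0)).add
      ((tendsto_mul_self_div_log_pow_zero hG h0 h).const_mul 2)
    rw [mul_zero, add_zero] at hup
    filter_upwards [hup.eventually_lt_const ha, eventually_gt_atTop 1] with x hx hx1
    have hl := Real.log_pos hx1
    refine lt_of_le_of_lt ?_ hx
    rw [← mul_div_assoc, ← mul_div_assoc, ← add_div]
    exact div_le_div_of_nonneg_right
      (gaussian_average_bounds hv hG h0 h1 (by linarith) one_pos).2 (by positivity)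

/-- A Breiman-type lemma: a tail `K (log x) ^ n / x` is multiplied by the mean of an independent
positive factor. -/
lemma tendsto_average_div {ν : Measure ℝ} [IsProbabilityMeasure ν] (hpos : ∀ᵐ a ∂ν, 0 < a)
    (hν : Integrable (fun a => a) ν) {G : ℝ → ℝ} (hG : Antitone G)
    (h0 : ∀ x, 0 ≤ G x) (h1 : ∀ x, G x ≤ 1) {n : ℕ} {K : ℝ}
    (h : Tendsto (fun x => G x * x / Real.log x ^ n) atTop (𝓝 K)) :
    Tendsto (fun x => (∫ a, G (x / a) ∂ν) * x / Real.log x ^ n) atTop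
      (𝓝 (K * ∫ a, a ∂ν)) := by
  have hC : ∀ᶠ x in atTop, G x * x / Real.log x ^ n ≤ K + 1 :=
    (h.eventually_lt_const (lt_add_one K)).mono fun x hx => hx.le
  obtain ⟨x₀, hx₀⟩ := eventually_atTop.1 (hC.and (eventually_ge_atTop (Real.exp 1)))
  have hx₀e : Real.exp 1 ≤ x₀ := (hx₀ x₀ le_rfl).2
  have hx₀0 : 0 < x₀ := (Real.exp_pos 1).trans_le hx₀e
  have hlog : ∀ x, x₀ ≤ x → 1 ≤ Real.log x := fun x hx =>
    (Real.le_log_iff_exp_le (hx₀0.trans_le hx)).2 (hx₀e.trans hx)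
  have hK1 : 0 ≤ K + 1 := by
    refine le_trans ?_ (hx₀ x₀ le_rfl).1
    have := hlog x₀ le_rfl
    have := h0 x₀
    positivity
  have hlim : Tendsto (fun x => ∫ a, G (x / a) * x / Real.log x ^ n ∂ν) atTop
      (𝓝 (∫ a, K * a ∂ν)) := by
    -- The dominating function covers three regimes: `a ≤ 1`, by monotonicity of `G`; `a > 1` with
    -- `x / a ≥ x₀`, by the tail bound at `x / a`; and `x / a < x₀`, by `G ≤ 1` and `x ≤ x₀ * a`.
    refine tendsto_integral_filter_of_dominated_convergence (fun a => (K + 1 + x₀) * (1 + a))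
      (Eventually.of_forall fun x => ?_) ?_ (((integrable_const 1).add hν).const_mul _) ?_
    · have : Measurable fun a : ℝ => G (x / a) :=
        hG.measurable.comp (measurable_const.div measurable_id)
      exact ((this.mul_const x).div_const _).aestronglyMeasurable
    · filter_upwards [eventually_ge_atTop x₀] with x hx
      filter_upwards [hpos] with a ha
      have hl := hlog x hx
      have hx0 : 0 < x := hx₀0.trans_le hx
      have hlp : 0 < Real.log x ^ n := by positivity
      have hG0 := h0 (x / a)
      rw [Real.norm_of_nonneg (by positivity), div_le_iff₀ hlp]
      have h2 : G x * x ≤ (K + 1) * Real.log x ^ n := (div_le_iff₀ hlp).1 (hx₀ x hx).1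
      have h3 : 1 ≤ Real.log x ^ n := one_le_pow₀ hl
      rcases le_or_gt a 1 with ha1 | ha1
      · have h4 : G (x / a) ≤ G x := hG (by rw [le_div_iff₀ ha]; nlinarith)
        have h5 : K + 1 ≤ (K + 1 + x₀) * (1 + a) := by nlinarith
        calc G (x / a) * x ≤ G x * x := by gcongr
          _ ≤ (K + 1) * Real.log x ^ n := h2
          _ ≤ _ := by gcongr
      · rcases le_or_gt x₀ (x / a) with hxa | hxa
        · have hla := hlog _ hxa
          have h6 : G (x / a) * (x / a) ≤ (K + 1) * Real.log (x / a) ^ n :=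
            (div_le_iff₀ (by positivity)).1 (hx₀ _ hxa).1
          have h7 : Real.log (x / a) ≤ Real.log x := by
            refine Real.log_le_log (by positivity) ?_
            rw [div_le_iff₀ ha]
            nlinarith
          have h8 : (K + 1) * a ≤ (K + 1 + x₀) * (1 + a) := by nlinarith
          calc G (x / a) * x = G (x / a) * (x / a) * a := by field_simp
            _ ≤ (K + 1) * Real.log (x / a) ^ n * a := by gcongr
            _ ≤ (K + 1) * Real.log x ^ n * a := by gcongr
            _ = (K + 1) * a * Real.log x ^ n := by ring
            _ ≤ _ := by gcongr
        · have h9 : x ≤ x₀ * a := ((div_lt_iff₀ ha).1 hxa).le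
          have h8 : x₀ * a ≤ (K + 1 + x₀) * (1 + a) := by nlinarith
          calc G (x / a) * x ≤ 1 * (x₀ * a) := by gcongr; exact h1 _
            _ = x₀ * a * 1 := by ring
            _ ≤ (K + 1 + x₀) * (1 + a) * Real.log x ^ n := by gcongr
    · filter_upwards [hpos] with a ha
      have h2 := (tendsto_comp_const_mul_div_log_pow (f := fun x => G x * x)
        (inv_pos.2 ha) h).mul_const a
      refine h2.congr fun x => ?_
      have : a⁻¹ * x = x / a := by field_simp
      rw [this]
      field_simp
  rw [integral_const_mul] at hlim
  refine hlim.congr fun x => ?_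
  rw [integral_div, integral_mul_const]

/-! ### Small-ball probabilities of Gaussian products, and symmetry -/

/-- The law of a pair of independent variables, computed by conditioning on the second one. -/
lemma measureReal_pair_eq_integral {Ω : Type*} [MeasurableSpace Ω] {P : Measure Ω}
    [IsProbabilityMeasure P] {U V : Ω → ℝ} (hU : AEMeasurable U P) (hV : AEMeasurable V P)
    (h : IndepFun U V P) {S : Set (ℝ × ℝ)} (hS : MeasurableSet S) :
    P.real {ω | (U ω, V ω) ∈ S} = ∫ v, P.real {ω | (U ω, v) ∈ S} ∂P.map V := by
  have hUp := Measure.isProbabilityMeasure_map hU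
  have hVp := Measure.isProbabilityMeasure_map hV
  have hm := (indepFun_iff_map_prod_eq_prod_map_map hU hV).1 h
  have h1 : P {ω | (U ω, V ω) ∈ S} = ∫⁻ v, P {ω | (U ω, v) ∈ S} ∂P.map V := by
    calc P {ω | (U ω, V ω) ∈ S} = (P.map fun ω => (U ω, V ω)) S :=
          (Measure.map_apply_of_aemeasurable (hU.prodMk hV) hS).symm
      _ = ∫⁻ v, (P.map U) ((fun u => (u, v)) ⁻¹' S) ∂P.map V := by
          rw [hm, Measure.prod_apply_symm hS]
      _ = _ := by
          refine lintegral_congr fun v => ?_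
          rw [Measure.map_apply_of_aemeasurable hU (measurable_prodMk_right hS)]
          rfl
  have hmeas : Measurable fun v => P {ω | (U ω, v) ∈ S} := by
    convert measurable_measure_prodMk_right (μ := P.map U) hS using 2 with v
    rw [Measure.map_apply_of_aemeasurable hU (measurable_prodMk_right hS)]
    rfl
  rw [Measure.real, h1,
    ← integral_toReal hmeas.aemeasurable (ae_of_all _ fun _ => measure_lt_top _ _)]
  rfl

/-- The probability that `U ≤ 1 / x`, for a nonnegative variable `U`. -/
noncomputable def smallTail {Ω : Type*} [MeasurableSpace Ω] (P : Measure Ω) (U : Ω → ℝ) (x : ℝ) :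
    ℝ :=
  P.real {ω | x * U ω ≤ 1}

section smallTail

variable {Ω : Type*} [MeasurableSpace Ω] {P : Measure Ω} [IsProbabilityMeasure P] {U V : Ω → ℝ}

omit [IsProbabilityMeasure P] in
lemma smallTail_nonneg (x : ℝ) : 0 ≤ smallTail P U x := measureReal_nonneg

lemma smallTail_le_one (x : ℝ) : smallTail P U x ≤ 1 := measureReal_le_one

lemma smallTail_antitone (hU0 : ∀ ω, 0 ≤ U ω) : Antitone (smallTail P U) := by
  intro a b hab
  refine measureReal_mono fun ω hω => ?_
  exact (mul_le_mul_of_nonneg_right hab (hU0 ω)).trans hω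

lemma smallTail_abs_mul (hU : AEMeasurable U P) (hV : AEMeasurable V P) (h : IndepFun U V P)
    (x : ℝ) :
    smallTail P (fun ω => |V ω| * U ω) x = ∫ y, smallTail P U (x * |y|) ∂P.map V := by
  have hS : MeasurableSet {z : ℝ × ℝ | x * (|z.2| * z.1) ≤ 1} :=
    measurableSet_le (by fun_prop) (by fun_prop)
  have := measureReal_pair_eq_integral hU hV h hS
  simp only [Set.mem_ofPred_eq, ← mul_assoc] at this
  simpa only [smallTail, ← mul_assoc] using this

/-- This puts a numerator `V` over a denominator `U` into the form of an average of `G (x / a)`;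
positivity of `V` allows the division. -/
lemma measureReal_mul_le_eq_integral (hU : AEMeasurable U P) (hV : AEMeasurable V P)
    (h : IndepFun U V P) (hV0 : ∀ᵐ ω ∂P, 0 < V ω) (x : ℝ) :
    P.real {ω | x * U ω ≤ V ω} = ∫ a, smallTail P U (x / a) ∂P.map V := by
  have hS : MeasurableSet {z : ℝ × ℝ | x * z.1 ≤ z.2} :=
    measurableSet_le (by fun_prop) (by fun_prop)
  have := measureReal_pair_eq_integral hU hV h hS
  simp only [Set.mem_ofPred_eq] at this
  rw [this]
  refine integral_congr_ae ?_
  have hpos : ∀ᵐ a ∂P.map V, 0 < a := (ae_map_iff hV measurableSet_Ioi).2 hV0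
  filter_upwards [hpos] with a ha
  unfold smallTail
  congr 1
  ext ω
  simp only [Set.mem_ofPred_eq]
  rw [div_mul_eq_mul_div, div_le_one ha]

/-- The base case: the constant variable `1`. -/
lemma tendsto_integral_smallTail_one :
    Tendsto (fun x => ∫ t in (0 : ℝ)..x, smallTail P (fun _ => 1) t) atTop (𝓝 1) := by
  refine tendsto_const_nhds.congr' ?_
  filter_upwards [eventually_ge_atTop 1] with x hx
  have hi : ∀ a b, IntervalIntegrable (smallTail P fun _ => 1) volume a b := fun a b =>
    (smallTail_antitone fun _ => zero_le_one).intervalIntegrable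
  rw [← intervalIntegral.integral_add_adjacent_intervals (hi 0 1) (hi 1 x)]
  have h1 : ∫ t in (0 : ℝ)..1, smallTail P (fun _ => 1) t = ∫ t in (0 : ℝ)..1, (1 : ℝ) := by
    refine intervalIntegral.integral_congr fun t ht => ?_
    rw [Set.uIcc_of_le zero_le_one] at ht
    simp [smallTail, ht.2]
  have h2 : ∫ t in (1 : ℝ)..x, smallTail P (fun _ => 1) t = ∫ t in (1 : ℝ)..x, (0 : ℝ) := by
    refine intervalIntegral.integral_congr_ae (ae_of_all _ fun t ht => ?_)
    rw [Set.uIoc_of_le hx] at ht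
    simp [smallTail, not_le.2 ht.1]
  rw [h1, h2]
  simp

lemma tendsto_smallTail_abs_mul {v : NNReal} (hv : v ≠ 0) (hU : AEMeasurable U P)
    (hU0 : ∀ ω, 0 ≤ U ω) (hV : HasLaw V (gaussianReal 0 v) P) (h : IndepFun U V P)
    {n : ℕ} {K : ℝ}
    (hK : Tendsto (fun x => (∫ t in (0 : ℝ)..x, smallTail P U t) / Real.log x ^ n) atTop (𝓝 K)) :
    Tendsto (fun x => smallTail P (fun ω => |V ω| * U ω) x * x / Real.log x ^ n) atTop
      (𝓝 (2 * gaussianPDFReal 0 v 0 * K)) := by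
  refine (tendsto_gaussian_average hv (smallTail_antitone hU0) smallTail_nonneg smallTail_le_one
    hK).congr fun x => ?_
  rw [smallTail_abs_mul hU hV.aemeasurable h, hV.map_eq]

omit [IsProbabilityMeasure P] in
lemma indepFun_prod_abs {ι : Type*} {Y : ι → Ω → ℝ} (hY : ∀ j, AEMeasurable (Y j) P)
    (hind : iIndepFun Y P) {s : Finset ι} {i : ι} (hi : i ∉ s) :
    IndepFun (fun ω => ∏ j ∈ s, |Y j ω|) (Y i) P := by
  have := (hind.indepFun_finsetProd_of_notMem₀ hY hi).comp
    (measurable_norm : Measurable fun x : ℝ => |x|) measurable_id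
  convert this using 1
  · ext ω
    simp
  · rfl

/-- Integrated small-ball asymptotics for products of independent centred Gaussians. -/
lemma tendsto_integral_smallTail_prod {ι : Type*} [DecidableEq ι] {Y : ι → Ω → ℝ} {v : ι → NNReal}
    (hv : ∀ j, v j ≠ 0) (hY : ∀ j, HasLaw (Y j) (gaussianReal 0 (v j)) P)
    (hind : iIndepFun Y P) (s : Finset ι) :
    Tendsto (fun x => (∫ t in (0 : ℝ)..x, smallTail P (fun ω => ∏ j ∈ s, |Y j ω|) t) /
      Real.log x ^ s.card) atTop
      (𝓝 ((∏ j ∈ s, 2 * gaussianPDFReal 0 (v j) 0) / (s.card ! : ℝ))) := by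
  induction s using Finset.induction_on with
  | empty => simpa using tendsto_integral_smallTail_one (P := P)
  | insert i s hi ih =>
    have h1 := tendsto_smallTail_abs_mul (hv i) (U := fun ω => ∏ j ∈ s, |Y j ω|)
      (Finset.aemeasurable_fun_prod _ fun j _ => (hY j).aemeasurable.norm)
      (fun ω => Finset.prod_nonneg fun j _ => abs_nonneg _) (hY i)
      (indepFun_prod_abs (fun j => (hY j).aemeasurable) hind hi) ih
    have h2 := tendsto_integral_div_log_pow
      (smallTail_antitone fun ω => mul_nonneg (abs_nonneg _)
        (Finset.prod_nonneg fun j _ => abs_nonneg _)) h1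
    simp only [Finset.prod_insert hi, Finset.card_insert_of_notMem hi]
    convert h2 using 2
    rw [Nat.factorial_succ]
    push_cast
    field_simp

/-- The induction runs on primitives, since for the empty product `G` itself eventually vanishes.
Here one factor is held back and multiplied in last without integrating, which leaves the exponent
`N - 1` and the divisor `(N - 1)!`. -/
lemma tendsto_smallTail_prod {N : ℕ} (hN : 1 ≤ N) {Y : Fin N → Ω → ℝ} {v : Fin N → NNReal}
    (hv : ∀ j, v j ≠ 0) (hY : ∀ j, HasLaw (Y j) (gaussianReal 0 (v j)) P)
    (hind : iIndepFun Y P) :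
    Tendsto (fun x => smallTail P (fun ω => ∏ j, |Y j ω|) x * x / Real.log x ^ (N - 1)) atTop
      (𝓝 ((∏ j, 2 * gaussianPDFReal 0 (v j) 0) / ((N - 1)! : ℝ))) := by
  obtain ⟨n, rfl⟩ : ∃ n, N = n + 1 := ⟨N - 1, by omega⟩
  have hi : (0 : Fin (n + 1)) ∉ Finset.univ.erase (0 : Fin (n + 1)) := Finset.notMem_erase _ _
  have hc : (Finset.univ.erase (0 : Fin (n + 1))).card = n := by simp
  have ih := tendsto_integral_smallTail_prod hv hY hind (Finset.univ.erase (0 : Fin (n + 1)))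
  have h1 := tendsto_smallTail_abs_mul (hv 0)
      (U := fun ω => ∏ j ∈ Finset.univ.erase (0 : Fin (n + 1)), |Y j ω|)
      (Finset.aemeasurable_fun_prod _ fun j _ => (hY j).aemeasurable.norm)
      (fun ω => Finset.prod_nonneg fun j _ => abs_nonneg _) (hY 0)
      (indepFun_prod_abs (fun j => (hY j).aemeasurable) hind hi) ih
  have he : (fun ω => |Y 0 ω| * ∏ j ∈ Finset.univ.erase (0 : Fin (n + 1)), |Y j ω|) =
      fun ω => ∏ j, |Y j ω| :=
    funext fun ω => Finset.mul_prod_erase Finset.univ (fun j => |Y j ω|) (Finset.mem_univ 0)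
  rw [hc, he] at h1
  simp only [Nat.add_sub_cancel]
  convert h1 using 2
  rw [← Finset.mul_prod_erase Finset.univ (fun j => 2 * gaussianPDFReal 0 (v j) 0)
    (Finset.mem_univ 0), mul_div_assoc]

/-- A product of independent variables, one of which is symmetric, is symmetric. -/
lemma measureReal_le_neg_of_symm (hU : AEMeasurable U P) (hV : AEMeasurable V P)
    (h : IndepFun U V P) (hsymm : P.map (fun ω => -V ω) = P.map V) {x : ℝ} (hx : 0 < x) :
    P.real {ω | U ω * V ω ≤ -x} = P.real {ω | x ≤ |U ω * V ω|} / 2 := by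
  have hid : IdentDistrib (fun ω => (U ω, -V ω)) (fun ω => (U ω, V ω)) P P :=
    (IdentDistrib.refl hU).prodMk ⟨hV.neg, hV, hsymm⟩
      (h.comp measurable_id measurable_neg) h
  have hS : MeasurableSet {z : ℝ × ℝ | z.1 * z.2 ≤ -x} :=
    measurableSet_le (by fun_prop) (by fun_prop)
  have h1 : P.real {ω | U ω * -V ω ≤ -x} = P.real {ω | U ω * V ω ≤ -x} := by
    have := hid.measure_mem_eq hS
    exact congrArg ENNReal.toReal this
  -- The two-sided event splits into two events, disjoint as `x > 0` and equally likely by symmetry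
  -- of `V`.
  have h2 : {ω | x ≤ |U ω * V ω|} = {ω | U ω * -V ω ≤ -x} ∪ {ω | U ω * V ω ≤ -x} := by
    ext ω
    simp only [Set.mem_ofPred_eq, Set.mem_union, le_abs, mul_neg, neg_le_neg_iff]
    rw [le_neg]
  have h3 : NullMeasurableSet {ω | U ω * V ω ≤ -x} P :=
    nullMeasurableSet_le (hU.mul hV) aemeasurable_const
  have h4 : Disjoint {ω | U ω * -V ω ≤ -x} {ω | U ω * V ω ≤ -x} := by
    rw [Set.disjoint_left]
    intro ω h5 h6
    simp only [Set.mem_ofPred_eq] at h5 h6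
    linarith
  rw [h2, measureReal_union₀ h3 h4.aedisjoint, h1]
  ring

end smallTail

/-! ### From tails to quantiles -/

/-- Two-sided tail bounds determine the lower quantile asymptotics. -/
lemma isEquivalent_quantile {μ : Measure ℝ} [IsProbabilityMeasure μ] {g : ℝ → ℝ}
    (hg : ∀ᶠ p in 𝓝[>] (0 : ℝ), 0 < g p)
    (hlow : ∀ c, 0 < c → c < 1 → ∀ᶠ p in 𝓝[>] (0 : ℝ), p ≤ μ.real (Set.Iic (-(c * g p))))
    (hup : ∀ c, 1 < c → ∀ᶠ p in 𝓝[>] (0 : ℝ), μ.real (Set.Iic (-(c * g p))) < p) :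
    (fun p => quantile μ p) ~[𝓝[>] 0] fun p => -g p := by
  rw [IsEquivalent, isLittleO_iff]
  intro ε hε
  -- The maximum keeps the constant positive when `ε ≥ 1`.
  have hc1 : max (1 - ε) (1 / 2) < 1 := max_lt (by linarith) (by norm_num)
  filter_upwards [hg, hlow _ (lt_max_of_lt_right (by norm_num)) hc1,
    hup (1 + ε) (by linarith)] with p hgp h1 h2
  have hmem : -(max (1 - ε) (1 / 2) * g p) ∈ {x : ℝ | p ≤ cdf μ x} := by
    simpa only [Set.mem_ofPred_eq, cdf_eq_real] using h1
  have hlb : ∀ x ∈ {x : ℝ | p ≤ cdf μ x}, -((1 + ε) * g p) ≤ x := by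
    intro x hx
    rw [Set.mem_ofPred_eq, cdf_eq_real] at hx
    by_contra hlt
    have := measureReal_mono (μ := μ) (Set.Iic_subset_Iic.2 (not_le.1 hlt).le)
    linarith
  have h3 : quantile μ p ≤ -(max (1 - ε) (1 / 2) * g p) := csInf_le ⟨_, hlb⟩ hmem
  have h4 : -((1 + ε) * g p) ≤ quantile μ p := le_csInf ⟨_, hmem⟩ hlb
  have h5 : (1 - ε) * g p ≤ max (1 - ε) (1 / 2) * g p := by
    gcongr
    exact le_max_left _ _
  simp only [Pi.sub_apply, Real.norm_eq_abs, abs_neg, abs_of_pos hgp, sub_neg_eq_add]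
  rw [abs_le]
  constructor <;> linarith

lemma tendsto_log_one_div : Tendsto (fun p : ℝ => Real.log (1 / p)) (𝓝[>] 0) atTop := by
  simp only [one_div]
  exact Real.tendsto_log_atTop.comp tendsto_inv_nhdsGT_zero

/-- Inversion of a tail `C (log x) ^ n / x`. -/
lemma isEquivalent_quantile_of_log_pow_div {μ : Measure ℝ} [IsProbabilityMeasure μ] {n : ℕ} {C : ℝ}
    (hC : 0 < C)
    (h : Tendsto (fun x => μ.real (Set.Iic (-x)) * x / Real.log x ^ n) atTop (𝓝 C)) :
    (fun p => quantile μ p) ~[𝓝[>] 0] fun p => -(C * (Real.log (1 / p) ^ n / p)) := by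
  have hp : ∀ᶠ p in 𝓝[>] (0 : ℝ), 0 < p := self_mem_nhdsWithin
  have hL1 : ∀ᶠ p in 𝓝[>] (0 : ℝ), 1 < Real.log (1 / p) :=
    tendsto_log_one_div.eventually_gt_atTop 1
  have hpos : ∀ᶠ p in 𝓝[>] (0 : ℝ), 0 < C * (Real.log (1 / p) ^ n / p) := by
    filter_upwards [hp, hL1] with p h1 h2
    positivity
  have key : ∀ c, 0 < c → Tendsto
      (fun p => μ.real (Set.Iic (-(c * (C * (Real.log (1 / p) ^ n / p))))) / p) (𝓝[>] 0)
      (𝓝 (1 / c)) := by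
    intro c hc
    set y : ℝ → ℝ := fun p => c * (C * (Real.log (1 / p) ^ n / p)) with hy
    have hytop : Tendsto y (𝓝[>] 0) atTop := by
      have h1 : Tendsto (fun p : ℝ => c * C * (1 / p)) (𝓝[>] 0) atTop := by
        simp only [one_div]
        exact tendsto_inv_nhdsGT_zero.const_mul_atTop (by positivity)
      refine tendsto_atTop_mono' _ ?_ h1
      filter_upwards [hp, hL1] with p h2 h3
      have h4 : 1 ≤ Real.log (1 / p) ^ n := one_le_pow₀ h3.le
      simp only [hy]
      rw [mul_assoc]
      gcongr
    -- With `L = log (1 / p)`, `log (y p) = log (c * C) + n * log L + L`, and `L` dominates.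
    have hlogy : Tendsto (fun p => Real.log (y p) / Real.log (1 / p)) (𝓝[>] 0) (𝓝 1) := by
      have h1 : Tendsto (fun L : ℝ => Real.log (c * C) / L + n * (Real.log L / L) + 1) atTop
          (𝓝 (0 + n * 0 + 1)) :=
        ((tendsto_const_nhds.div_atTop tendsto_id).add
          ((Real.isLittleO_log_id_atTop.tendsto_div_nhds_zero).const_mul (n : ℝ))).add_const 1
      rw [mul_zero, zero_add, zero_add] at h1
      refine (h1.comp tendsto_log_one_div).congr' ?_
      filter_upwards [hp, hL1] with p h2 h3
      have hL : Real.log (1 / p) ≠ 0 := by linarith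
      have : y p = c * C * (Real.log (1 / p) ^ n * (1 / p)) := by
        simp only [hy]
        ring
      have h1p : 1 / p ≠ 0 := by positivity
      rw [this, Real.log_mul (mul_ne_zero hc.ne' hC.ne') (by positivity),
        Real.log_mul (pow_ne_zero n hL) h1p, Real.log_pow]
      simp only [Function.comp]
      field_simp
      ring
    have h1 := ((h.comp hytop).mul (hlogy.pow n)).mul_const (1 / (c * C))
    have h2 : C * 1 ^ n * (1 / (c * C)) = 1 / c := by
      rw [one_pow]
      field_simp
    rw [h2] at h1
    refine h1.congr' ?_
    filter_upwards [hp, hL1, hytop.eventually_gt_atTop 1] with p h3 h4 h5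
    have hly : Real.log (y p) ≠ 0 := (Real.log_pos h5).ne'
    have hL : Real.log (1 / p) ≠ 0 := by linarith
    have hyp : y p = c * (C * (Real.log (1 / p) ^ n / p)) := rfl
    rw [← hyp]
    simp only [Function.comp, div_pow]
    generalize Real.log (y p) = l at *
    generalize μ.real (Set.Iic (-y p)) = m
    rw [hyp]
    field_simp
  refine isEquivalent_quantile hpos (fun c hc hc1 => ?_) fun c hc => ?_
  · have h1 : (1 : ℝ) < 1 / c := by rwa [lt_div_iff₀ hc, one_mul]
    filter_upwards [(key c hc).eventually_const_lt h1, hp] with p h2 h3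
    rw [lt_div_iff₀ h3, one_mul] at h2
    exact h2.le
  · have hc0 : 0 < c := by linarith
    have h1 : 1 / c < (1 : ℝ) := by rwa [div_lt_iff₀ hc0, one_mul]
    filter_upwards [(key c hc0).eventually_lt_const h1, hp] with p h2 h3
    rwa [div_lt_iff₀ h3, one_mul] at h2

/-- Inversion of a tail of Weibull type. -/
lemma isEquivalent_quantile_of_exp_tail {μ : Measure ℝ} [IsProbabilityMeasure μ] {m s : ℝ}
    (hm : 0 < m) (hs : 0 < s)
    (hlow : ∀ b, m < b → ∀ᶠ t in atTop, Real.exp (-(b * t)) ≤ μ.real (Set.Iic (-(s * t ^ m))))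
    (hup : ∀ b, b < m → ∀ᶠ t in atTop, μ.real (Set.Iic (-(s * t ^ m))) < Real.exp (-(b * t))) :
    (fun p => quantile μ p) ~[𝓝[>] 0] fun p => -(s * (Real.log (1 / p) / m) ^ m) := by
  have hp : ∀ᶠ p in 𝓝[>] (0 : ℝ), 0 < p := self_mem_nhdsWithin
  have hL1 : ∀ᶠ p in 𝓝[>] (0 : ℝ), 1 < Real.log (1 / p) :=
    tendsto_log_one_div.eventually_gt_atTop 1
  -- The choice `t = c ^ m⁻¹ / m * log (1 / p)` makes `s * t ^ m` equal to `c` times the claimed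
  -- quantile size, and `exp (-(b * t)) = p` for `b = m / c ^ m⁻¹`. This `b` exceeds `m` exactly
  -- when `c < 1`.
  have htop : ∀ c : ℝ, 0 < c →
      Tendsto (fun p : ℝ => c ^ m⁻¹ / m * Real.log (1 / p)) (𝓝[>] 0) atTop :=
    fun c hc => tendsto_log_one_div.const_mul_atTop (by positivity)
  have hexp : ∀ c : ℝ, 0 < c → ∀ p : ℝ, 0 < p →
      Real.exp (-(m / c ^ m⁻¹ * (c ^ m⁻¹ / m * Real.log (1 / p)))) = p := by
    intro c hc p hp
    have : c ^ m⁻¹ ≠ 0 := by positivity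
    have h1 : -(m / c ^ m⁻¹ * (c ^ m⁻¹ / m * Real.log (1 / p))) = Real.log p := by
      rw [one_div, Real.log_inv]
      field_simp
    rw [h1, Real.exp_log hp]
  have hpow : ∀ c : ℝ, 0 < c → ∀ p : ℝ, 1 < Real.log (1 / p) →
      s * (c ^ m⁻¹ / m * Real.log (1 / p)) ^ m = c * (s * (Real.log (1 / p) / m) ^ m) := by
    intro c hc p h1
    have h2 : c ^ m⁻¹ / m * Real.log (1 / p) = c ^ m⁻¹ * (Real.log (1 / p) / m) := by ring
    rw [h2, Real.mul_rpow (by positivity) (by positivity), Real.rpow_inv_rpow hc.le hm.ne']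
    ring
  refine isEquivalent_quantile ?_ (fun c hc hc1 => ?_) fun c hc => ?_
  · filter_upwards [hL1] with p h1
    positivity
  · have h1 : m < m / c ^ m⁻¹ := by
      rw [lt_div_iff₀ (by positivity)]
      exact mul_lt_of_lt_one_right hm (Real.rpow_lt_one hc.le hc1 (by positivity))
    filter_upwards [(htop c hc).eventually (hlow _ h1), hp, hL1] with p h2 h3 h4
    rwa [hexp c hc p h3, hpow c hc p h4] at h2
  · have hc0 : 0 < c := by linarith
    have h1 : m / c ^ m⁻¹ < m := by
      rw [div_lt_iff₀ (by positivity)]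
      exact lt_mul_of_one_lt_right hm (Real.one_lt_rpow hc (by positivity))
    filter_upwards [(htop c hc0).eventually (hup _ h1), hp, hL1] with p h2 h3 h4
    rwa [hexp c hc0 p h3, hpow c hc0 p h4] at h2

/-! ### Tails of products of standard Gaussians -/

lemma integrable_exp_mul_sq_gaussianReal {a : ℝ} (ha : a < 1 / 2) :
    Integrable (fun y => Real.exp (a * y ^ 2)) (gaussianReal 0 1) := by
  -- A non-integrable function has integral `0` by convention, so a nonzero value proves
  -- integrability.
  refine Integrable.of_integral_ne_zero ?_
  rw [integral_gaussianReal_eq_integral_smul one_ne_zero]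
  have h : ∀ y : ℝ, gaussianPDFReal 0 1 y • Real.exp (a * y ^ 2) =
      (√(2 * Real.pi))⁻¹ * Real.exp (-(1 / 2 - a) * y ^ 2) := by
    intro y
    simp only [gaussianPDFReal, NNReal.coe_one, mul_one, sub_zero, smul_eq_mul]
    rw [mul_assoc, ← Real.exp_add]
    ring_nf
  simp only [h]
  rw [integral_const_mul, integral_gaussian]
  have : 0 < 1 / 2 - a := by linarith
  positivity

/-- The density on `[r, r + 1]` is at least its value at the right end. This is crude but has the
right exponent to leading order. -/
lemma measureReal_abs_ge_gaussianReal {r : ℝ} (hr : 0 ≤ r) :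
    gaussianPDFReal 0 1 (r + 1) ≤ (gaussianReal 0 1).real {y | r ≤ |y|} := by
  have h1 : gaussianPDFReal 0 1 (r + 1) ≤ ∫ y in Set.Icc r (r + 1), gaussianPDFReal 0 1 y := by
    have : ∫ _ in Set.Icc r (r + 1), gaussianPDFReal 0 1 (r + 1) =
        gaussianPDFReal 0 1 (r + 1) := by simp
    rw [← this]
    refine setIntegral_mono_on (integrable_const _) (integrable_gaussianPDFReal 0 1).integrableOn
      measurableSet_Icc fun y hy => ?_
    exact gaussianPDFReal_zero_antitoneOn 1 (hr.trans hy.1) (show (0 : ℝ) ≤ r + 1 by linarith) hy.2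
  have h2 : (gaussianReal 0 1).real (Set.Icc r (r + 1)) =
      ∫ y in Set.Icc r (r + 1), gaussianPDFReal 0 1 y := by
    rw [Measure.real, gaussianReal_apply_eq_integral 0 one_ne_zero, ENNReal.toReal_ofReal]
    exact setIntegral_nonneg measurableSet_Icc fun y _ => gaussianPDFReal_nonneg 0 1 y
  rw [← h2] at h1
  exact h1.trans (measureReal_mono fun y hy => hy.1.trans (le_abs_self y))

section StandardProduct

variable {Ω : Type*} [MeasurableSpace Ω] {P : Measure Ω} [IsProbabilityMeasure P] {M : ℕ}
  {W : Fin M → Ω → ℝ}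

/-- The Chernoff bound for a product of standard Gaussians, through the AM-GM inequality. -/
lemma exists_measureReal_prod_ge_le (hM : 1 ≤ M) (hW : ∀ i, HasLaw (W i) (gaussianReal 0 1) P)
    (hind : iIndepFun W P) {a : ℝ} (ha0 : 0 ≤ a) (ha : a < 1 / 2) :
    ∃ C : ℝ, ∀ t : ℝ, 0 ≤ t →
      P.real {ω | t ^ ((M : ℝ) / 2) ≤ ∏ i, |W i ω|} ≤ C * Real.exp (-(a * M * t)) := by
  have hM0 : (0 : ℝ) < M := by exact_mod_cast hM
  have hWm : ∀ i, AEMeasurable (fun ω => W i ω ^ 2) P := fun i => (hW i).aemeasurable.pow_const 2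
  have hsq : iIndepFun (fun i ω => W i ω ^ 2) P :=
    hind.comp (fun _ y => y ^ 2) fun _ => by fun_prop
  have hint : ∀ i, Integrable (fun ω => Real.exp (a * W i ω ^ 2)) P := by
    intro i
    have h := integrable_exp_mul_sq_gaussianReal ha
    rw [← (hW i).map_eq] at h
    exact h.comp_aemeasurable (hW i).aemeasurable
  have hmgf := hsq.mgf_sum₀ (t := a) hWm Finset.univ
  have hmpos : 0 < mgf (∑ i, fun ω => W i ω ^ 2) P a := by
    rw [hmgf]
    exact Finset.prod_pos fun i _ => mgf_pos (hint i)
  have hsumint : Integrable (fun ω => Real.exp (a * (∑ i, fun ω => W i ω ^ 2) ω)) P :=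
    Integrable.of_integral_ne_zero hmpos.ne'
  refine ⟨mgf (∑ i, fun ω => W i ω ^ 2) P a, fun t ht => ?_⟩
  have hcher := measure_ge_le_exp_mul_mgf (M * t) ha0 hsumint
  have hrw : -a * (M * t) = -(a * M * t) := by ring
  rw [hrw, mul_comm (Real.exp _)] at hcher
  refine (measureReal_mono fun ω hω => ?_).trans hcher
  simp only [Set.mem_ofPred_eq, Finset.sum_apply] at hω ⊢
  have hamgm := Real.geom_mean_le_arith_mean_weighted Finset.univ (fun _ : Fin M => (M : ℝ)⁻¹)
    (fun i => W i ω ^ 2) (fun _ _ => by positivity) (by simp [hM0.ne'])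
    (fun _ _ => by positivity)
  rw [← Finset.mul_sum] at hamgm
  have h1 : ∏ i, (W i ω ^ 2) ^ (M : ℝ)⁻¹ = (∏ i, |W i ω|) ^ (2 / (M : ℝ)) := by
    rw [← Real.finsetProd_rpow _ _ fun i _ => abs_nonneg _]
    refine Finset.prod_congr rfl fun i _ => ?_
    rw [← sq_abs, ← Real.rpow_natCast, ← Real.rpow_mul (abs_nonneg _)]
    rfl
  have h2 : t ≤ (∏ i, |W i ω|) ^ (2 / (M : ℝ)) := by
    calc t = (t ^ ((M : ℝ) / 2)) ^ (2 / (M : ℝ)) := by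
          rw [← Real.rpow_mul ht]
          have : (M : ℝ) / 2 * (2 / M) = 1 := by field_simp
          rw [this, Real.rpow_one]
      _ ≤ _ := Real.rpow_le_rpow (by positivity) hω (by positivity)
  rw [h1, inv_mul_eq_div, le_div_iff₀ hM0] at hamgm
  nlinarith

lemma measureReal_prod_ge_ge (hW : ∀ i, HasLaw (W i) (gaussianReal 0 1) P)
    (hind : iIndepFun W P) {t : ℝ} (ht : 0 ≤ t) :
    gaussianPDFReal 0 1 (√t + 1) ^ M ≤ P.real {ω | t ^ ((M : ℝ) / 2) ≤ ∏ i, |W i ω|} := by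
  have hS : MeasurableSet {y : ℝ | √t ≤ |y|} := measurableSet_le (by fun_prop) (by fun_prop)
  have h1 := hind.measure_inter_preimage_eq_mul Finset.univ
    (sets := fun _ => {y : ℝ | √t ≤ |y|}) fun _ _ => hS
  have h2 : ∀ i, P.real (W i ⁻¹' {y : ℝ | √t ≤ |y|}) = (gaussianReal 0 1).real {y | √t ≤ |y|} := by
    intro i
    rw [← (hW i).map_eq, map_measureReal_apply_of_aemeasurable (hW i).aemeasurable hS]
  have h3 : P.real (⋂ i ∈ Finset.univ, W i ⁻¹' {y : ℝ | √t ≤ |y|}) =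
      (gaussianReal 0 1).real {y | √t ≤ |y|} ^ M := by
    have := congrArg ENNReal.toReal h1
    rw [ENNReal.toReal_prod] at this
    change P.real _ = ∏ i, P.real _ at this
    rw [this, Finset.prod_congr rfl fun i _ => h2 i]
    simp
  calc gaussianPDFReal 0 1 (√t + 1) ^ M ≤ (gaussianReal 0 1).real {y | √t ≤ |y|} ^ M :=
        pow_le_pow_left₀ (gaussianPDFReal_nonneg _ _ _)
          (measureReal_abs_ge_gaussianReal (Real.sqrt_nonneg t)) M
    _ = _ := h3.symm
    _ ≤ _ := measureReal_mono fun ω hω => ?_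
  simp only [Finset.mem_univ, Set.iInter_true, Set.mem_iInter, Set.mem_preimage,
    Set.mem_ofPred_eq] at hω ⊢
  calc t ^ ((M : ℝ) / 2) = ∏ _i : Fin M, √t := by
        rw [Finset.prod_const, Finset.card_univ, Fintype.card_fin, Real.sqrt_eq_rpow,
          ← Real.rpow_natCast, ← Real.rpow_mul ht]
        ring_nf
    _ ≤ _ := Finset.prod_le_prod (fun _ _ => Real.sqrt_nonneg t) fun i _ => hω i

lemma eventually_half_measureReal_prod_lt (hM : 1 ≤ M)
    (hW : ∀ i, HasLaw (W i) (gaussianReal 0 1) P) (hind : iIndepFun W P) {b : ℝ}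
    (hb : b < (M : ℝ) / 2) :
    ∀ᶠ t : ℝ in atTop,
      P.real {ω | t ^ ((M : ℝ) / 2) ≤ ∏ i, |W i ω|} / 2 < Real.exp (-(b * t)) := by
  have hM0 : (0 : ℝ) < M := by exact_mod_cast hM
  -- The rate `b'` lies strictly between `b` and `M / 2`, so that the Chernoff constant is absorbed;
  -- the maximum with `0` makes `b' / M` an admissible parameter even for negative `b`.
  obtain ⟨b', hb', hb'M⟩ := exists_between (max_lt hb (by positivity : (0 : ℝ) < M / 2))
  have hbb : b < b' := (le_max_left _ _).trans_lt hb'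
  have hb0 : 0 < b' := (le_max_right _ _).trans_lt hb'
  obtain ⟨C, hC⟩ := exists_measureReal_prod_ge_le hM hW hind (a := b' / M) (by positivity)
    (by rw [div_lt_iff₀ hM0]; linarith)
  have hexp : Tendsto (fun t : ℝ => Real.exp ((b' - b) * t)) atTop atTop :=
    Real.tendsto_exp_atTop.comp (tendsto_id.const_mul_atTop (by linarith))
  filter_upwards [eventually_ge_atTop 0, hexp.eventually_gt_atTop (C / 2)] with t ht h1
  have h2 := hC t ht
  rw [div_mul_cancel₀ _ hM0.ne'] at h2
  calc _ ≤ C / 2 * Real.exp (-(b' * t)) := by linarith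
    _ < Real.exp ((b' - b) * t) * Real.exp (-(b' * t)) := by gcongr
    _ = _ := by
      rw [← Real.exp_add]
      ring_nf

lemma eventually_le_half_measureReal_prod (hW : ∀ i, HasLaw (W i) (gaussianReal 0 1) P)
    (hind : iIndepFun W P) {b : ℝ} (hb : (M : ℝ) / 2 < b) :
    ∀ᶠ t : ℝ in atTop,
      Real.exp (-(b * t)) ≤ P.real {ω | t ^ ((M : ℝ) / 2) ≤ ∏ i, |W i ω|} / 2 := by
  set c : ℝ := (√(2 * Real.pi))⁻¹ with hc
  have hc0 : 0 < c := by positivity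
  -- With `r = √t` this is the exponent `b * t - M / 2 * (√t + 1) ^ 2`; its bracket tends to `b - M
  -- / 2 > 0`.
  have hlim : Tendsto (fun r : ℝ => r ^ 2 * (b - M / 2 * (1 + 1 / r) ^ 2)) atTop atTop := by
    refine (tendsto_pow_atTop two_ne_zero).atTop_mul_pos (C := b - M / 2 * (1 + 0) ^ 2)
      (by linarith) ?_
    exact tendsto_const_nhds.sub
      (((tendsto_const_nhds.div_atTop tendsto_id).const_add 1).pow 2 |>.const_mul _)
  have hexp := (Real.tendsto_exp_atTop.comp hlim).comp Real.tendsto_sqrt_atTop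
  filter_upwards [eventually_gt_atTop 0, hexp.eventually_ge_atTop (2 / c ^ M)] with t ht h1
  have h2 := measureReal_prod_ge_ge hW hind ht.le
  have hs : 0 < √t := Real.sqrt_pos.2 ht
  have h3 : gaussianPDFReal 0 1 (√t + 1) ^ M = c ^ M * Real.exp (-(M / 2 * (√t + 1) ^ 2)) := by
    simp only [gaussianPDFReal, NNReal.coe_one, mul_one, sub_zero]
    rw [mul_pow, ← Real.exp_nat_mul]
    congr 2
    ring
  rw [h3] at h2
  simp only [Function.comp] at h1
  rw [div_le_iff₀ (by positivity)] at h1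
  have h4 : √t ^ 2 * (b - M / 2 * (1 + 1 / √t) ^ 2) = b * t - M / 2 * (√t + 1) ^ 2 := by
    have : √t ^ 2 * (b - M / 2 * (1 + 1 / √t) ^ 2) = b * √t ^ 2 - M / 2 * (√t + 1) ^ 2 := by
      field_simp
    rw [this, Real.sq_sqrt ht.le]
  rw [h4] at h1
  have h5 : Real.exp (-(M / 2 * (√t + 1) ^ 2)) =
      Real.exp (b * t - M / 2 * (√t + 1) ^ 2) * Real.exp (-(b * t)) := by
    rw [← Real.exp_add]
    ring_nf
  rw [h5] at h2
  have h6 := Real.exp_pos (-(b * t))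
  nlinarith

end StandardProduct

/-! ### The ratio: symmetry, independence and constants -/

lemma integral_abs_gaussianReal {v : NNReal} (hv : v ≠ 0) :
    ∫ y, |y| ∂gaussianReal 0 v = 2 * gaussianPDFReal 0 v 0 * v := by
  have hv0 : (0 : ℝ) < v := by positivity
  rw [integral_comp_abs_gaussianReal hv fun y => y]
  have h : ∀ y ∈ Set.Ioi (0 : ℝ), gaussianPDFReal 0 v y * y = gaussianPDFReal 0 v 0 *
      (y ^ (1 : ℝ) * Real.exp (-(1 / (2 * v)) * y ^ (2 : ℝ))) := by
    intro y _
    rw [Real.rpow_one, Real.rpow_two]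
    simp only [gaussianPDFReal, sub_zero]
    have : -y ^ 2 / (2 * (v : ℝ)) = -(1 / (2 * v)) * y ^ 2 := by ring
    rw [this]
    simp
    ring
  rw [setIntegral_congr_fun measurableSet_Ioi h, integral_const_mul,
    integral_rpow_mul_exp_neg_mul_rpow (by norm_num) (by norm_num) (by positivity)]
  have h1 : -((1 : ℝ) + 1) / 2 = -1 := by norm_num
  have h2 : ((1 : ℝ) + 1) / 2 = 1 := by norm_num
  rw [h1, h2, Real.Gamma_one, Real.rpow_neg_one]
  field_simp

lemma gaussianPDFReal_sq_zero {σ : ℝ} (hσ : 0 < σ) :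
    gaussianPDFReal 0 (.mk (σ ^ 2) (sq_nonneg σ)) 0 = (√(2 * Real.pi))⁻¹ / σ := by
  simp only [gaussianPDFReal, NNReal.coe_mk]
  rw [Real.sqrt_mul (by positivity), Real.sqrt_sq hσ.le]
  simp [div_eq_mul_inv, mul_comm]

section Ratio

variable {Ω : Type*} [MeasurableSpace Ω] {P : Measure Ω} [IsProbabilityMeasure P]

omit [IsProbabilityMeasure P] in
lemma HasLaw.map_neg_gaussianReal_zero {X : Ω → ℝ} {v : NNReal}
    (hX : HasLaw X (gaussianReal 0 v) P) : P.map (fun ω => -X ω) = P.map X := by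
  have h := (gaussianReal_neg hX).map_eq
  rw [neg_zero] at h
  rw [hX.map_eq, ← h]
  rfl

omit [IsProbabilityMeasure P] in
lemma HasLaw.ae_ne_zero_gaussianReal {X : Ω → ℝ} {μ : ℝ} {v : NNReal} (hv : v ≠ 0)
    (hX : HasLaw X (gaussianReal μ v) P) : ∀ᵐ ω ∂P, X ω ≠ 0 := by
  have hn := nullSingletonClass_gaussianReal (μ := μ) hv
  have h : ∀ᵐ y ∂P.map X, y ≠ 0 := by
    rw [hX.map_eq]
    exact compl_mem_ae_iff.2 (measure_singleton (μ := gaussianReal μ v) 0)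
  exact ae_of_ae_map hX.aemeasurable h

/-- A nonempty product of independent symmetric variables is symmetric. -/
lemma measureReal_prod_le_neg {ι : Type*} [Fintype ι] [Nonempty ι] [DecidableEq ι]
    {W : ι → Ω → ℝ} (hW : ∀ i, AEMeasurable (W i) P) (hind : iIndepFun W P)
    (hsymm : ∀ i, P.map (fun ω => -W i ω) = P.map (W i)) {x : ℝ} (hx : 0 < x) :
    P.real {ω | ∏ i, W i ω ≤ -x} = P.real {ω | x ≤ |∏ i, W i ω|} / 2 := by
  obtain ⟨k⟩ := ‹Nonempty ι›
  have h := measureReal_le_neg_of_symm (U := ∏ i ∈ Finset.univ.erase k, W i)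
    (Finset.aemeasurable_prod _ fun i _ => hW i) (hW k)
    (hind.indepFun_finsetProd_of_notMem₀ hW (Finset.notMem_erase _ _)) (hsymm k) hx
  have he : ∀ ω, (∏ i ∈ Finset.univ.erase k, W i) ω * W k ω = ∏ i, W i ω := by
    intro ω
    rw [Finset.prod_apply]
    exact Finset.prod_erase_mul Finset.univ (fun i => W i ω) (Finset.mem_univ k)
  simpa only [he] using h

variable {M N : ℕ} {X : Fin M → Ω → ℝ} {Y : Fin N → Ω → ℝ} {v : Fin M → NNReal}
  {w : Fin N → NNReal}

omit [IsProbabilityMeasure P] in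
lemma aemeasurable_productRatio (hX : ∀ i, AEMeasurable (X i) P)
    (hY : ∀ j, AEMeasurable (Y j) P) : AEMeasurable (productRatio X Y) P :=
  (Finset.aemeasurable_fun_prod _ fun i _ => hX i).div
    (Finset.aemeasurable_fun_prod _ fun j _ => hY j)

/-- The lower tail of the ratio is half of the two-sided tail. -/
lemma map_productRatio_real_Iic_neg (hMN : 1 ≤ M + N)
    (hX : ∀ i, HasLaw (X i) (gaussianReal 0 (v i)) P)
    (hY : ∀ j, HasLaw (Y j) (gaussianReal 0 (w j)) P)
    (hind : iIndepFun (Sum.elim X Y) P) {x : ℝ} (hx : 0 < x) :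
    (P.map (productRatio X Y)).real (Set.Iic (-x)) = P.real {ω | x ≤ |productRatio X Y ω|} / 2 := by
  have hne : Nonempty (Fin M ⊕ Fin N) := by
    rw [← Fintype.card_pos_iff]
    rw [Fintype.card_sum, Fintype.card_fin, Fintype.card_fin]
    exact hMN
  rw [map_measureReal_apply_of_aemeasurable (aemeasurable_productRatio
    (fun i => (hX i).aemeasurable) fun j => (hY j).aemeasurable) measurableSet_Iic]
  -- The ratio is one product over `Fin M ⊕ Fin N`, with factors `X i` and `(Y j)⁻¹`. Inversion is
  -- odd on all of `ℝ`, as `0⁻¹ = 0`, so symmetry passes to the inverses.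
  have hi := hind.comp (Sum.elim (fun _ y => y) fun _ y => y⁻¹) (by
    rintro (i | j)
    · exact measurable_id
    · exact measurable_inv)
  have h := measureReal_prod_le_neg (x := x) (W := fun k =>
    (Sum.elim (fun _ y => y) (fun _ y => y⁻¹) : Fin M ⊕ Fin N → ℝ → ℝ) k ∘ Sum.elim X Y k)
    ?_ hi ?_ hx
  · have he : ∀ ω, (∏ k, ((Sum.elim (fun _ y => y) (fun _ y => y⁻¹) : Fin M ⊕ Fin N → ℝ → ℝ) k ∘
        Sum.elim X Y k) ω) = productRatio X Y ω := by
      intro ω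
      simp [productRatio, Fintype.prod_sum_type, div_eq_mul_inv]
    simp only [he] at h
    exact h
  · rintro (i | j)
    · exact (hX i).aemeasurable
    · exact (hY j).aemeasurable.inv
  · rintro (i | j)
    · exact HasLaw.map_neg_gaussianReal_zero (hX i)
    · have h1 := HasLaw.map_neg_gaussianReal_zero (hY j)
      have h2 := congrArg (Measure.map fun y : ℝ => y⁻¹) h1
      rw [AEMeasurable.map_map_of_aemeasurable measurable_inv.aemeasurable
        (show AEMeasurable (fun ω => -Y j ω) P from (hY j).aemeasurable.neg),
        AEMeasurable.map_map_of_aemeasurable measurable_inv.aemeasurable (hY j).aemeasurable] at h2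
      rw [← show (fun y : ℝ => y⁻¹) ∘ Y j = (Sum.elim (fun _ y => y) (fun _ y => y⁻¹) :
        Fin M ⊕ Fin N → ℝ → ℝ) (Sum.inr j) ∘ Sum.elim X Y (Sum.inr j) from rfl, ← h2]
      congr 1
      ext ω
      simp [inv_neg]

omit [IsProbabilityMeasure P] in
lemma indepFun_prod_abs_prod_abs (hX : ∀ i, AEMeasurable (X i) P) (hY : ∀ j, AEMeasurable (Y j) P)
    (hind : iIndepFun (Sum.elim X Y) P) :
    IndepFun (fun ω => ∏ j, |Y j ω|) (fun ω => ∏ i, |X i ω|) P := by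
  classical
  have hd : Disjoint (Finset.univ.map (Function.Embedding.inr : Fin N ↪ Fin M ⊕ Fin N))
      (Finset.univ.map Function.Embedding.inl) := by
    rw [Finset.disjoint_left]
    simp
  have h := hind.indepFun_finset₀ _ _ hd (by
    rintro (i | j)
    · exact hX i
    · exact hY j)
  have hB : Measurable fun f :
      Finset.univ.map (Function.Embedding.inr : Fin N ↪ Fin M ⊕ Fin N) → ℝ =>
        ∏ j : Fin N, |f ⟨Sum.inr j, by simp⟩| :=
    Finset.measurable_fun_prod _ fun j _ => (measurable_pi_apply _).norm
  have hA : Measurable fun f :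
      Finset.univ.map (Function.Embedding.inl : Fin M ↪ Fin M ⊕ Fin N) → ℝ =>
        ∏ i : Fin M, |f ⟨Sum.inl i, by simp⟩| :=
    Finset.measurable_fun_prod _ fun i _ => (measurable_pi_apply _).norm
  exact h.comp hB hA

/-- Power-law tails of the ratio when the denominator is nonempty. -/
lemma tendsto_map_productRatio_tail (hN : 1 ≤ N) (hv : ∀ i, v i ≠ 0) (hw : ∀ j, w j ≠ 0)
    (hX : ∀ i, HasLaw (X i) (gaussianReal 0 (v i)) P)
    (hY : ∀ j, HasLaw (Y j) (gaussianReal 0 (w j)) P)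
    (hind : iIndepFun (Sum.elim X Y) P) :
    Tendsto (fun x => (P.map (productRatio X Y)).real (Set.Iic (-x)) * x / Real.log x ^ (N - 1))
      atTop (𝓝 ((∏ j, 2 * gaussianPDFReal 0 (w j) 0) / ((N - 1)! : ℝ) *
        (∏ i, 2 * gaussianPDFReal 0 (v i) 0 * v i) / 2)) := by
  have hXm := fun i => (hX i).aemeasurable
  have hYm := fun j => (hY j).aemeasurable
  have hXind : iIndepFun X P := iIndepFun.precomp (f := Sum.elim X Y) Sum.inl_injective hind
  have hYind : iIndepFun Y P := iIndepFun.precomp (f := Sum.elim X Y) Sum.inr_injective hind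
  have hX0 : ∀ᵐ ω ∂P, ∀ i, X i ω ≠ 0 :=
    ae_all_iff.2 fun i => HasLaw.ae_ne_zero_gaussianReal (hv i) (hX i)
  have hY0 : ∀ᵐ ω ∂P, ∀ j, Y j ω ≠ 0 :=
    ae_all_iff.2 fun j => HasLaw.ae_ne_zero_gaussianReal (hw j) (hY j)
  set A : Ω → ℝ := fun ω => ∏ i, |X i ω| with hA
  have hAm : AEMeasurable A P := Finset.aemeasurable_fun_prod _ fun i _ => (hXm i).norm
  have hBm : AEMeasurable (fun ω => ∏ j, |Y j ω|) P :=
    Finset.aemeasurable_fun_prod _ fun j _ => (hYm j).norm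
  have hApos : ∀ᵐ ω ∂P, 0 < A ω := by
    filter_upwards [hX0] with ω h
    exact Finset.prod_pos fun i _ => abs_pos.2 (h i)
  have hAint : ∫ ω, A ω ∂P = ∏ i, 2 * gaussianPDFReal 0 (v i) 0 * v i := by
    have h1 : iIndepFun (fun i ω => |X i ω|) P :=
      hXind.comp (fun _ y => |y|) fun _ => measurable_norm
    rw [hA, h1.integral_fun_prod_eq_prod_integral fun i => (hXm i).norm.aestronglyMeasurable]
    refine Finset.prod_congr rfl fun i _ => ?_
    rw [← integral_abs_gaussianReal (hv i), ← (hX i).map_eq]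
    exact (integral_map (hXm i) measurable_norm.aestronglyMeasurable).symm
  have hAi : Integrable A P := by
    refine Integrable.of_integral_ne_zero ?_
    rw [hAint]
    refine Finset.prod_ne_zero_iff.2 fun i _ => ?_
    have := gaussianPDFReal_pos 0 (v i) 0 (hv i)
    have := hv i
    positivity
  have hAprob := Measure.isProbabilityMeasure_map hAm
  have hlim := tendsto_average_div (ν := P.map A) ((ae_map_iff hAm measurableSet_Ioi).2 hApos)
    ((integrable_map_measure measurable_id.aestronglyMeasurable hAm).2 hAi)
    (smallTail_antitone (P := P) fun ω => Finset.prod_nonneg fun j _ => abs_nonneg (Y j ω))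
    smallTail_nonneg smallTail_le_one (tendsto_smallTail_prod hN hw hY hYind)
  rw [show ∫ a, a ∂P.map A = ∫ ω, A ω ∂P from
    integral_map hAm measurable_id.aestronglyMeasurable, hAint] at hlim
  refine (hlim.div_const 2).congr' ?_
  filter_upwards [eventually_gt_atTop 0] with x hx
  rw [map_productRatio_real_Iic_neg (by omega) hX hY hind hx,
    ← measureReal_mul_le_eq_integral hBm hAm (indepFun_prod_abs_prod_abs hXm hYm hind) hApos]
  -- Clearing the denominator is valid only where no `Y j` vanishes, hence almost surely.
  have he : P.real {ω | x * ∏ j, |Y j ω| ≤ A ω} = P.real {ω | x ≤ |productRatio X Y ω|} := by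
    refine measureReal_congr ?_
    filter_upwards [hY0] with ω h
    have hB : 0 < ∏ j, |Y j ω| := Finset.prod_pos fun j _ => abs_pos.2 (h j)
    refine propext ?_
    change x * ∏ j, |Y j ω| ≤ A ω ↔ x ≤ |productRatio X Y ω|
    rw [productRatio, abs_div, Finset.abs_prod, Finset.abs_prod, le_div_iff₀ hB]
  rw [he]
  ring

end Ratio

/-- Each of the `M + N` variables contributes `2 / √(2π)`, besides its `σ` or `1 / σ`; the final
half comes from symmetry. -/
lemma half_mul_pow_const (m n : ℕ) :
    (2 * (√(2 * Real.pi))⁻¹) ^ (m + n) / 2 =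
      (2 : ℝ) ^ (((m : ℝ) + (n : ℝ) - 2) / 2) / Real.pi ^ (((m : ℝ) + (n : ℝ)) / 2) := by
  have h2 : 2 * (√(2 * Real.pi))⁻¹ = √(2 / Real.pi) := by
    rw [Real.sqrt_mul (by norm_num), Real.sqrt_div (by norm_num)]
    have : √2 * √2 = 2 := Real.mul_self_sqrt (by norm_num)
    have h1 : √2 ≠ 0 := by positivity
    have h3 : √Real.pi ≠ 0 := by positivity
    field_simp
    rw [pow_two, this]
  rw [h2, Real.sqrt_eq_rpow, ← Real.rpow_natCast, ← Real.rpow_mul (by positivity),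
    Real.div_rpow (by norm_num) Real.pi_pos.le, sub_div, Real.rpow_sub (by norm_num)]
  push_cast
  have h4 : (1 : ℝ) / 2 * (m + n) = (m + n) / 2 := by ring
  rw [h4]
  norm_num
  ring

/-! ### The quantile asymptotics -/

theorem theorem2p6 {Ω : Type*} [MeasurableSpace Ω] (P : Measure Ω) [IsProbabilityMeasure P]
    (M N : ℕ) (X : Fin M → Ω → ℝ) (Y : Fin N → Ω → ℝ)
    (σX : Fin M → ℝ) (σY : Fin N → ℝ)
    (hσX : ∀ i, 0 < σX i) (hσY : ∀ j, 0 < σY j)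
    (hX : ∀ i, HasLaw (X i) (gaussianReal 0 ⟨σX i ^ 2, sq_nonneg (σX i)⟩) P)
    (hY : ∀ j, HasLaw (Y j) (gaussianReal 0 ⟨σY j ^ 2, sq_nonneg (σY j)⟩) P)
    (hindep : iIndepFun (Sum.elim X Y) P) :
    (1 ≤ N →
      (fun p : ℝ => quantile (P.map (productRatio X Y)) p) ~[𝓝[>] 0]
        (fun p : ℝ =>
          -((2 : ℝ) ^ (((M : ℝ) + (N : ℝ) - 2) / 2) * (∏ i, σX i) /
              (Real.pi ^ (((M : ℝ) + (N : ℝ)) / 2) * (∏ j, σY j) * ((N - 1)! : ℝ))) *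
            (Real.log (1 / p) ^ (N - 1) / p))) ∧
    (1 ≤ M → N = 0 →
      (fun p : ℝ => quantile (P.map (productRatio X Y)) p) ~[𝓝[>] 0]
        (fun p : ℝ =>
          -((2 * (∏ i, σX i) ^ (2 / (M : ℝ)) / (M : ℝ) * Real.log (1 / p)) ^ ((M : ℝ) / 2)))) := by
  replace hX : ∀ i, HasLaw (X i) (gaussianReal 0 (.mk (σX i ^ 2) (sq_nonneg (σX i)))) P := hX
  replace hY : ∀ j, HasLaw (Y j) (gaussianReal 0 (.mk (σY j ^ 2) (sq_nonneg (σY j)))) P := hY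
  have hprob : IsProbabilityMeasure (P.map (productRatio X Y)) :=
    Measure.isProbabilityMeasure_map (aemeasurable_productRatio
      (fun i => (hX i).aemeasurable) fun j => (hY j).aemeasurable)
  have hsX : 0 < ∏ i, σX i := Finset.prod_pos fun i _ => hσX i
  have hsY : 0 < ∏ j, σY j := Finset.prod_pos fun j _ => hσY j
  have hne : ∀ {σ : ℝ}, 0 < σ → NNReal.mk (σ ^ 2) (sq_nonneg σ) ≠ 0 := fun h h0 =>
    (pow_pos h 2).ne' (congrArg NNReal.toReal h0)
  constructor
  · intro hN
    have h := tendsto_map_productRatio_tail hN (fun i => hne (hσX i)) (fun j => hne (hσY j))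
      hX hY hindep
    have hC : (∏ j, 2 * gaussianPDFReal 0 (.mk (σY j ^ 2) (sq_nonneg (σY j))) 0) / ((N - 1)! : ℝ) *
        (∏ i, 2 * gaussianPDFReal 0 (.mk (σX i ^ 2) (sq_nonneg (σX i))) 0 *
          (NNReal.mk (σX i ^ 2) (sq_nonneg (σX i)) : ℝ)) / 2 =
        (2 : ℝ) ^ (((M : ℝ) + (N : ℝ) - 2) / 2) * (∏ i, σX i) /
          (Real.pi ^ (((M : ℝ) + (N : ℝ)) / 2) * (∏ j, σY j) * ((N - 1)! : ℝ)) := by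
      have h1 : ∏ j, 2 * gaussianPDFReal 0 (.mk (σY j ^ 2) (sq_nonneg (σY j))) 0 =
          (2 * (√(2 * Real.pi))⁻¹) ^ N / ∏ j, σY j := by
        simp only [gaussianPDFReal_sq_zero (hσY _), ← mul_div_assoc]
        rw [Finset.prod_div_distrib]
        simp
      have h2 : ∏ i, 2 * gaussianPDFReal 0 (.mk (σX i ^ 2) (sq_nonneg (σX i))) 0 *
          (NNReal.mk (σX i ^ 2) (sq_nonneg (σX i)) : ℝ) =
          (2 * (√(2 * Real.pi))⁻¹) ^ M * ∏ i, σX i := by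
        have h3 : ∀ i, 2 * gaussianPDFReal 0 (.mk (σX i ^ 2) (sq_nonneg (σX i))) 0 *
            (NNReal.mk (σX i ^ 2) (sq_nonneg (σX i)) : ℝ) =
            2 * (√(2 * Real.pi))⁻¹ * σX i := by
          intro i
          rw [gaussianPDFReal_sq_zero (hσX i), NNReal.coe_mk]
          have := (hσX i).ne'
          field_simp
        rw [Finset.prod_congr rfl fun i _ => h3 i, Finset.prod_mul_distrib]
        simp
      have h4 := half_mul_pow_const M N
      have h5 : ((N - 1)! : ℝ) ≠ 0 := by positivity
      rw [h1, h2]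
      calc _ = (2 * (√(2 * Real.pi))⁻¹) ^ (M + N) / 2 *
            ((∏ i, σX i) / ((∏ j, σY j) * ((N - 1)! : ℝ))) := by
            rw [pow_add]
            field_simp
        _ = _ := by rw [h4, div_mul_div_comm, ← mul_assoc]
    rw [hC] at h
    simp only [neg_mul]
    exact isEquivalent_quantile_of_log_pow_div (by positivity) h
  · rintro hM rfl
    have hM0 : (0 : ℝ) < M := by exact_mod_cast hM
    have hW : ∀ i, HasLaw (fun ω => X i ω / σX i) (gaussianReal 0 1) P := by
      intro i
      have h := gaussianReal_div_const (hX i) (σX i)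
      convert h using 2
      · simp
      · have := (hσX i).ne'
        ext
        simp [this]
    have hWind : iIndepFun (fun i ω => X i ω / σX i) P :=
      (hindep.precomp Sum.inl_injective).comp (fun i y => y / σX i) fun i => by fun_prop
    have htail : ∀ᶠ t : ℝ in atTop,
        (P.map (productRatio X Y)).real (Set.Iic (-((∏ i, σX i) * t ^ ((M : ℝ) / 2)))) =
          P.real {ω | t ^ ((M : ℝ) / 2) ≤ ∏ i, |X i ω / σX i|} / 2 := by
      filter_upwards [eventually_gt_atTop 0] with t ht
      rw [map_productRatio_real_Iic_neg (by omega) hX hY hindep (by positivity)]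
      congr 2
      ext ω
      have h1 : ∏ i, |X i ω / σX i| = |productRatio X Y ω| / ∏ i, σX i := by
        simp only [abs_div, Finset.prod_div_distrib, productRatio, Finset.univ_eq_empty,
          Finset.prod_empty, div_one, Finset.abs_prod]
        simp only [abs_of_pos (hσX _)]
      rw [Set.mem_ofPred_eq, Set.mem_ofPred_eq, h1, le_div_iff₀ hsX, mul_comm]
    have h := isEquivalent_quantile_of_exp_tail (μ := P.map (productRatio X Y))
      (m := (M : ℝ) / 2) (by positivity) hsX
      (fun b hb => by
        filter_upwards [htail, eventually_le_half_measureReal_prod hW hWind hb] with t h1 h2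
        rwa [h1])
      (fun b hb => by
        filter_upwards [htail, eventually_half_measureReal_prod_lt hM hW hWind hb] with t h1 h2
        rwa [h1])
    refine h.congr_right ?_
    filter_upwards [tendsto_log_one_div.eventually_gt_atTop 0] with p hp
    have h1 : 2 * (∏ i, σX i) ^ (2 / (M : ℝ)) / (M : ℝ) * Real.log (1 / p) =
        (∏ i, σX i) ^ (2 / (M : ℝ)) * (Real.log (1 / p) / (M / 2)) := by
      field_simp
    have h2 : 2 / (M : ℝ) * (M / 2) = 1 := by field_simp
    rw [h1, Real.mul_rpow (by positivity) (by positivity), ← Real.rpow_mul hsX.le, h2,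
      Real.rpow_one]
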